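/- **Theorem 3.5.** Let $q,r:\mathbb R\to\mathbb C$ belong to the Schwartz class $\mathcal S(\mathbb R)$, and for $\zeta\in\mathbb C$, $\lambda=\zeta^2$, consider the linear system $$\frac{d}{dx}\begin{bmatrix}\alpha\\ \beta\end{bmatrix}=\begin{bmatrix}-i\zeta^2-\frac i2\,q(x)r(x)&\zeta q(x)\\ \zeta r(x)&i\zeta^2+\frac i2\,q(x)r(x)\end{bmatrix}\begin{bmatrix}\alpha\\ \beta\end{bmatrix},\qquad x\in\mathbb R.$$ Write $\overline{\mathbb C^{\pm}}=\{\lambda\in\mathbb C:\pm\operatorname{Im}\lambda\ge 0\}$. The Jost solutions are the solutions of this system with the spatial asymptotics $$\psi(\zeta,x)=\begin{bmatrix}o(1)\\ e^{i\zeta^2x}[1+o(1)]\end{bmatrix},\quad \bar\psi(\zeta,x)=\begin{bmatrix}e^{-i\zeta^2x}[1+o(1)]\\ o(1)\end{bmatrix},\qquad x\to+\infty,$$ $$\phi(\zeta,x)=\begin{bmatrix}e^{-i\zeta^2x}[1+o(1)]\\ o(1)\end{bmatrix},\quad \bar\phi(\zeta,x)=\begin{bmatrix}o(1)\\ e^{i\zeta^2x}[1+o(1)]\end{bmatrix},\qquad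 x\to-\infty;$$ $\psi$ and $\phi$ exist and are unique for every $\zeta$ with $\zeta^2\in\overline{\mathbb C^+}$, and $\bar\psi$ and $\bar\phi$ exist and are unique for every $\zeta$ with $\zeta^2\in\overline{\mathbb C^-}$. Subscripts $1,2$ denote the components. Put $$\sigma(x):=-\frac i2\,q(x)\,r'(x)-\frac14\,q(x)^2\,r(x)^2 .$$ Then, for each fixed $x\in\mathbb R$, as $\lambda=\zeta^2\to\infty$ in $\overline{\mathbb C^+}$, $$\frac{\psi_1(\zeta,x)}{\zeta}=e^{i\lambda x}\left[\frac{q(x)}{2i\lambda}+O\!\left(\frac1{\lambda^2}\right)\right],$$ $$\psi_2(\zeta,x)=e^{i\lambda x}\left[1+\frac{q(x)r(x)}{4\lambda}-\frac1{2i\lambda}\int_x^\infty\sigma(y)\,dy+O\!\left(\frac1{\lambda^2}\right)\right],$$ $$\phi_1(\zeta,x)=e^{-i\lambda x}\left[1-\frac1{2i\lambda}\int_{-\infty}^x\sigma(y)\,dy+O\!\left(\frac1{\lambda^2}\right)\right],$$ $$\frac{\phi_2(\zeta,x)}{\zeta}=e^{-i\lambda x}\left[\frac{i\,r(x)}{2\lambda}+O\!\left(\frac1{\lambda^2}\right)\right],$$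 and, as $\lambda=\zeta^2\to\infty$ in $\overline{\mathbb C^-}$, $$\bar\psi_1(\zeta,x)=e^{-i\lambda x}\left[1+\frac1{2i\lambda}\int_x^\infty\sigma(y)\,dy+O\!\left(\frac1{\lambda^2}\right)\right],$$ $$\frac{\bar\psi_2(\zeta,x)}{\zeta}=e^{-i\lambda x}\left[-\frac{r(x)}{2i\lambda}+O\!\left(\frac1{\lambda^2}\right)\right],$$ $$\frac{\bar\phi_1(\zeta,x)}{\zeta}=e^{i\lambda x}\left[\frac{q(x)}{2i\lambda}+O\!\left(\frac1{\lambda^2}\right)\right],$$ $$\bar\phi_2(\zeta,x)=e^{i\lambda x}\left[1+\frac{q(x)r(x)}{4\lambda}+\frac1{2i\lambda}\int_{-\infty}^x\sigma(y)\,dy+O\!\left(\frac1{\lambda^2}\right)\right].$$ -/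

import Mathlib

open Complex Filter Topology Asymptotics
open scoped SchwartzMap Matrix

noncomputable section

/-- The coefficient matrix of the linear system at the spectral parameter `ζ` and the point `x`. -/
def coeffMatrix (q r : 𝓢(ℝ, ℂ)) (ζ : ℂ) (x : ℝ) : Matrix (Fin 2) (Fin 2) ℂ :=
  !![-I * ζ ^ 2 - I / 2 * q x * r x, ζ * q x;
     ζ * r x, I * ζ ^ 2 + I / 2 * q x * r x]

/-- `f = [α, β]ᵀ` is a solution on the whole real line of the linear system. -/
def IsSolution (q r : 𝓢(ℝ, ℂ)) (ζ : ℂ) (f : ℝ → Fin 2 → ℂ) : Prop :=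
  ∀ x : ℝ, HasDerivAt f (coeffMatrix q r ζ x *ᵥ f x) x

/-- The Jost solution `ψ(ζ, ·)`: as `x → +∞`,
the first component is `o(1)` and the second is `e^{iζ²x} [1 + o(1)]`. -/
structure IsJostPsi (q r : 𝓢(ℝ, ℂ)) (ζ : ℂ) (f : ℝ → Fin 2 → ℂ) : Prop where
  solution : IsSolution q r ζ f
  fst : Tendsto (fun x => f x 0) atTop (𝓝 0)
  snd : Tendsto (fun x : ℝ => f x 1 / exp (I * ζ ^ 2 * x)) atTop (𝓝 1)

/-- The Jost solution `ψ̄(ζ, ·)`: as `x → +∞`,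
the first component is `e^{-iζ²x} [1 + o(1)]` and the second is `o(1)`. -/
structure IsJostPsiBar (q r : 𝓢(ℝ, ℂ)) (ζ : ℂ) (f : ℝ → Fin 2 → ℂ) : Prop where
  solution : IsSolution q r ζ f
  fst : Tendsto (fun x : ℝ => f x 0 / exp (-I * ζ ^ 2 * x)) atTop (𝓝 1)
  snd : Tendsto (fun x => f x 1) atTop (𝓝 0)

/-- The Jost solution `φ(ζ, ·)`: as `x → -∞`,
the first component is `e^{-iζ²x} [1 + o(1)]` and the second is `o(1)`. -/
structure IsJostPhi (q r : 𝓢(ℝ, ℂ)) (ζ : ℂ) (f : ℝ → Fin 2 → ℂ) : Prop where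
  solution : IsSolution q r ζ f
  fst : Tendsto (fun x : ℝ => f x 0 / exp (-I * ζ ^ 2 * x)) atBot (𝓝 1)
  snd : Tendsto (fun x => f x 1) atBot (𝓝 0)

/-- The Jost solution `φ̄(ζ, ·)`: as `x → -∞`,
the first component is `o(1)` and the second is `e^{iζ²x} [1 + o(1)]`. -/
structure IsJostPhiBar (q r : 𝓢(ℝ, ℂ)) (ζ : ℂ) (f : ℝ → Fin 2 → ℂ) : Prop where
  solution : IsSolution q r ζ f
  fst : Tendsto (fun x => f x 0) atBot (𝓝 0)
  snd : Tendsto (fun x : ℝ => f x 1 / exp (I * ζ ^ 2 * x)) atBot (𝓝 1)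

/-- `σ = -(i/2) q r' - (1/4) q² r²`. -/
def sigma (q r : 𝓢(ℝ, ℂ)) (x : ℝ) : ℂ :=
  -(I / 2) * q x * deriv r x - 1 / 4 * q x ^ 2 * r x ^ 2

/-- The limit `λ = ζ² → ∞` in the closed upper half-plane, as a filter in the variable `ζ`
(both square roots `ζ` of `λ` are allowed). -/
def lamInfUpper : Filter ℂ :=
  comap (fun ζ : ℂ => ζ ^ 2) (Bornology.cobounded ℂ ⊓ 𝓟 {l : ℂ | 0 ≤ l.im})

/-- The limit `λ = ζ² → ∞` in the closed lower half-plane, as a filter in the variable `ζ`. -/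
def lamInfLower : Filter ℂ :=
  comap (fun ζ : ℂ => ζ ^ 2) (Bornology.cobounded ℂ ⊓ 𝓟 {l : ℂ | l.im ≤ 0})

/-- `F = e^{s i λ x} [G + O(1/λ²)]` along the filter `l`, where `λ = ζ²` and `s = ±1`:
there is a remainder `ρ = O(1/λ²)` with `F = e^{s i λ x} (G + ρ)` eventually along `l`. -/
def ExpBracket (l : Filter ℂ) (s : ℂ) (x : ℝ) (F G : ℂ → ℂ) : Prop :=
  ∃ ρ : ℂ → ℂ, ρ =O[l] (fun ζ => 1 / (ζ ^ 2) ^ 2) ∧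
    ∀ᶠ ζ in l, F ζ = exp (s * I * ζ ^ 2 * x) * (G ζ + ρ ζ)

end

section

open MeasureTheory Set

/-! Everything reduces to `ψ`. Writing `ψ = e^{iλx} (ζ u, w + (i/2) r u)` removes the growing factor
`ζ` from the off-diagonal entries: the system becomes `u' = -2iλ u + q w`, `w' = p u` with `p =
-(i/2) r' - (1/4) q r²`, so that `q p = σ`. The Jost normalisation turns this into a Volterra system
whose kernels are bounded by integrable functions independent of `λ` when `Im λ ≥ 0`. It is solvable
with bounds uniform in `λ` (`exists_volterra_solution`).

Integration by parts against `e^{2iλ(y-x)}` gives `u = O(1/λ)`, hence `w - 1 = O(1/λ)`; a second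
round gives `u = q/(2iλ) + O(1/λ²)`, and integrating `p u` yields the `σ` term of `w`
(`volterra_expansion`). The correction `(i/2) r u` contributes `qr/(4λ)`. Uniqueness comes from the
constancy of the Wronskian (`IsJostPsi.unique`).

The other three Jost solutions are images of `ψ`, for transformed potentials, under exchange of
components, reflection in `x`, or both. Exchanging `q` and `r` changes `σ` by a total derivative,
which accounts for the presence or absence of `qr/(4λ)` in the various formulas. -/

theorem hasDerivAt_integral_Ioi {E : Type*} [NormedAddCommGroup E] [NormedSpace ℝ E]
    [CompleteSpace E] {g : ℝ → E} (hc : Continuous g) (hi : ∀ x, IntegrableOn g (Ioi x)) (x : ℝ) :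
    HasDerivAt (fun x => ∫ y in Ioi x, g y) (-g x) x := by
  have h : (fun t => ∫ y in Ioi t, g y) =
      fun t => (∫ y in Ioi x, g y) - ∫ y in x..t, g y := by
    funext t
    rw [eq_sub_iff_add_eq']
    exact intervalIntegral.integral_interval_add_Ioi (hi x) (hi t)
  rw [h]
  exact (intervalIntegral.integral_hasDerivAt_right (hc.intervalIntegrable _ _)
    (hc.stronglyMeasurableAtFilter _ _) hc.continuousAt).const_sub _

/-! ### Oscillating tail integrals. -/

/-- The Volterra operator with oscillating kernel `e^{2il(y-x)}` on the half-line `y > x`. -/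
noncomputable def oscTail (l : ℂ) (h : ℝ → ℂ) (x : ℝ) : ℂ :=
  ∫ y in Set.Ioi x, exp (2 * I * l * (y - x)) * h y

theorem norm_exp_osc_le {l : ℂ} (hl : 0 ≤ l.im) {x y : ℝ} (hxy : x ≤ y) :
    ‖exp (2 * I * l * (y - x))‖ ≤ 1 := by
  rw [norm_exp, Real.exp_le_one_iff]
  have : (2 * I * l * (y - x)).re = -(2 * l.im * (y - x)) := by simp
  rw [this]
  have := sub_nonneg.2 hxy
  have := mul_nonneg hl this
  nlinarith

theorem integrableOn_osc {l : ℂ} (hl : 0 ≤ l.im) {h : ℝ → ℂ} {x : ℝ} (hi : IntegrableOn h (Ioi x)) :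
    IntegrableOn (fun y : ℝ => exp (2 * I * l * (y - x)) * h y) (Ioi x) := by
  refine Integrable.bdd_mul (c := 1) hi (by fun_prop) ?_
  filter_upwards [ae_restrict_mem measurableSet_Ioi] with y hy
  exact norm_exp_osc_le hl hy.le

theorem norm_oscTail_le {l : ℂ} (hl : 0 ≤ l.im) {h : ℝ → ℂ} {g : ℝ → ℝ} {x : ℝ}
    (hg : IntegrableOn g (Ioi x)) (hb : ∀ y, ‖h y‖ ≤ g y) :
    ‖oscTail l h x‖ ≤ ∫ y in Ioi x, g y := by
  refine norm_integral_le_of_norm_le hg ?_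
  filter_upwards [ae_restrict_mem measurableSet_Ioi] with y hy
  rw [norm_mul]
  exact (mul_le_of_le_one_left (norm_nonneg _) (norm_exp_osc_le hl hy.le)).trans (hb y)

theorem norm_oscTail_le_integral {l : ℂ} (hl : 0 ≤ l.im) {h : ℝ → ℂ} {g : ℝ → ℝ}
    (hg : Integrable g) (hb : ∀ y, ‖h y‖ ≤ g y) (x : ℝ) :
    ‖oscTail l h x‖ ≤ ∫ y, g y :=
  (norm_oscTail_le hl hg.integrableOn hb).trans
    (setIntegral_le_integral hg (Eventually.of_forall fun y => (norm_nonneg _).trans (hb y)))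

theorem tendsto_oscTail {l : ℂ} (hl : 0 ≤ l.im) {h : ℝ → ℂ} (hi : Integrable h) :
    Tendsto (oscTail l h) atTop (𝓝 0) :=
  squeeze_zero_norm (fun _ => norm_oscTail_le hl hi.norm.integrableOn fun _ => le_rfl)
    (tendsto_integral_Ioi_zero tendsto_id)

theorem oscTail_sub {l : ℂ} (hl : 0 ≤ l.im) {h k : ℝ → ℂ} (hh : Integrable h) (hk : Integrable k)
    (x : ℝ) : oscTail l h x - oscTail l k x = oscTail l (fun y => h y - k y) x := by
  unfold oscTail
  rw [← integral_sub (integrableOn_osc hl hh.integrableOn) (integrableOn_osc hl hk.integrableOn)]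
  simp only [mul_sub]

theorem hasDerivAt_oscTail {l : ℂ} (hl : 0 ≤ l.im) {h : ℝ → ℂ} (hc : Continuous h)
    (hi : Integrable h) (x : ℝ) :
    HasDerivAt (oscTail l h) (-2 * I * l * oscTail l h x - h x) x := by
  -- The kernel factors as `e^{-2ilt} e^{2ily}`, so only an exponential prefactor and the lower
  -- limit depend on `t`.
  have key : oscTail l h = fun t : ℝ =>
      exp (-2 * I * l * t) * ∫ y in Ioi t, exp (2 * I * l * y) * h y := by
    funext t
    rw [oscTail, ← integral_const_mul]
    congr 1
    funext y
    rw [← mul_assoc, ← exp_add]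
    ring_nf
  have hint : ∀ t : ℝ, IntegrableOn (fun y : ℝ => exp (2 * I * l * y) * h y) (Ioi t) := by
    intro t
    refine ((integrableOn_osc hl hi.integrableOn (x := t)).const_mul (exp (2 * I * l * t))).congr ?_
    refine Eventually.of_forall fun y => ?_
    simp only
    rw [← mul_assoc, ← exp_add]
    ring_nf
  have h1 := hasDerivAt_integral_Ioi (by fun_prop) hint x
  have h2 : HasDerivAt (fun t : ℝ => exp (-2 * I * l * t))
      (exp (-2 * I * l * x) * (-2 * I * l * 1)) x :=
    ((hasDerivAt_id (x : ℂ)).comp_ofReal.const_mul (-2 * I * l)).cexp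
  rw [key]
  convert! h2.mul h1 using 1
  have : exp (-2 * I * l * x) * exp (2 * I * l * x) = 1 := by
    rw [← exp_add]; ring_nf; simp
  linear_combination (h x) * this

theorem continuous_oscTail {l : ℂ} (hl : 0 ≤ l.im) {h : ℝ → ℂ} (hc : Continuous h)
    (hi : Integrable h) : Continuous (oscTail l h) :=
  continuous_iff_continuousAt.2 fun x => (hasDerivAt_oscTail hl hc hi x).continuousAt

/-- Integration by parts in the oscillating kernel. -/
theorem oscTail_by_parts {l : ℂ} (hl : 0 ≤ l.im) (hl0 : l ≠ 0) {h h' : ℝ → ℂ}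
    (hd : ∀ y, HasDerivAt h (h' y) y) (hi : Integrable h) (hi' : Integrable h') (x : ℝ) :
    oscTail l h x = -(h x + oscTail l h' x) / (2 * I * l) := by
  have hd' : ∀ y : ℝ, HasDerivAt (fun y : ℝ => exp (2 * I * l * (y - x)) * h y)
      (2 * I * l * (exp (2 * I * l * (y - x)) * h y) + exp (2 * I * l * (y - x)) * h' y) y := by
    intro y
    have h2 : HasDerivAt (fun y : ℝ => exp (2 * I * l * (y - x)))
        (exp (2 * I * l * (y - x)) * (2 * I * l * 1)) y :=
      (((hasDerivAt_id (y : ℂ)).comp_ofReal.sub_const _).const_mul (2 * I * l)).cexp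
    convert! h2.mul (hd y) using 1
    ring
  have I1 := integrableOn_osc hl hi.integrableOn (x := x)
  have I2 := integrableOn_osc hl hi'.integrableOn (x := x)
  have I3 := (I1.const_mul (2 * I * l)).add I2
  -- The boundary term at `+∞` vanishes because the function and its derivative are both integrable;
  -- decay of the kernel is not needed, so real `l` is covered.
  have ht := tendsto_zero_of_hasDerivAt_of_integrableOn_Ioi (a := x) (fun y _ => hd' y) I3 I1
  have e := integral_Ioi_of_hasDerivAt_of_tendsto' (a := x) (fun y _ => hd' y) I3 ht
  rw [integral_add (I1.const_mul _) I2, integral_const_mul] at e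
  simp only [sub_self, mul_zero, exp_zero, one_mul, zero_sub] at e
  have hne : 2 * I * l ≠ 0 := by simp [hl0]
  rw [eq_div_iff hne]
  unfold oscTail
  linear_combination e

/-! ### The Volterra system, solved uniformly in `λ`. -/

/-- A Banach fixed point in a weighted sup norm. `K` precedes `l` because the kernel has modulus at
most 1 throughout the closed upper half-plane. The second equation uses `oscTail 0`, the plain tail
integral. -/
theorem exists_volterra_solution {q p : ℝ → ℂ} (hqc : Continuous q) (hpc : Continuous p)
    (hqi : Integrable q) (hpi : Integrable p) :
    ∃ K : ℝ, 0 ≤ K ∧ ∀ l : ℂ, 0 ≤ l.im → ∃ u w : ℝ → ℂ, Continuous u ∧ Continuous w ∧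
      (∀ x, ‖u x‖ ≤ K) ∧ (∀ x, ‖w x‖ ≤ K) ∧
      (∀ x, u x = -oscTail l (fun y => q y * w y) x) ∧
      (∀ x, w x = 1 - oscTail 0 (fun y => p y * u y) x) := by
  set m : ℝ → ℝ := fun y => ‖q y‖ + ‖p y‖ with hm
  have hm0 : ∀ y, 0 ≤ m y := fun y => by positivity
  have hmc : Continuous m := by fun_prop
  have hmi : Integrable m := hqi.norm.add hpi.norm
  set M : ℝ → ℝ := fun x => ∫ y in Ioi x, m y with hM
  have hMd : ∀ x, HasDerivAt M (-m x) x :=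
    hasDerivAt_integral_Ioi hmc fun x => hmi.integrableOn
  have hM0 : ∀ x, 0 ≤ M x := fun x => integral_nonneg hm0
  have hM1 : ∀ x, M x ≤ ∫ y, m y := fun x =>
    setIntegral_le_integral hmi (Eventually.of_forall hm0)
  -- The weight satisfies `E' = -2 m E` and `E → 1` at `+∞`, so the tail integral of `m E` is `(E -
  -- 1)/2`. The factor 2 in the exponent is what yields contraction constant 1/2, with no smallness
  -- of `q` or `p`.
  set E : ℝ → ℝ := fun x => Real.exp (2 * M x) with hE
  have hE1 : ∀ x, 1 ≤ E x := fun x => Real.one_le_exp (by linarith [hM0 x])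
  have hE0 : ∀ x, 0 < E x := fun x => Real.exp_pos _
  set E₀ : ℝ := Real.exp (2 * ∫ y, m y) with hE₀
  have hEb : ∀ x, E x ≤ E₀ := fun x => Real.exp_le_exp.2 (by linarith [hM1 x])
  have hEd : ∀ x, HasDerivAt E (-2 * (m x * E x)) x := fun x => by
    convert! ((hMd x).const_mul 2).exp using 1
    simp only [hE]; ring
  have hEc : Continuous E := continuous_iff_continuousAt.2 fun x => (hEd x).continuousAt
  have hmEi : Integrable fun y => m y * E y :=
    hmi.mul_bdd (c := E₀) hEc.aestronglyMeasurable
      (Eventually.of_forall fun x => by rw [Real.norm_of_nonneg (hE0 x).le]; exact hEb x)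
  have hint : ∀ x, ∫ y in Ioi x, m y * E y = (E x - 1) / 2 := by
    intro x
    have ht : Tendsto E atTop (𝓝 1) := by
      have : Tendsto M atTop (𝓝 0) := tendsto_integral_Ioi_zero tendsto_id
      simpa using (this.const_mul 2).rexp
    have := integral_Ioi_of_hasDerivAt_of_tendsto' (a := x) (fun y _ => hEd y)
      (hmEi.const_mul (-2)).integrableOn ht
    rw [integral_const_mul] at this
    linarith
  have hosc : ∀ l : ℂ, 0 ≤ l.im → ∀ (h : ℝ → ℂ) (C : ℝ), 0 ≤ C → (∀ y, ‖h y‖ ≤ C * (m y * E y)) →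
      ∀ x, ‖oscTail l h x‖ ≤ C / 2 * E x := by
    intro l hl h C hC hb x
    refine (norm_oscTail_le hl (hmEi.const_mul C).integrableOn hb).trans ?_
    rw [integral_const_mul, hint]
    linarith
  have hosci : ∀ (h : ℝ → ℂ) (C : ℝ), Continuous h → (∀ y, ‖h y‖ ≤ C * (m y * E y)) →
      Integrable h := fun h C hc hb =>
    (hmEi.const_mul C).mono' hc.aestronglyMeasurable (Eventually.of_forall hb)
  have hb1 : ∀ (f : ℝ → ℂ) (C : ℝ), (∀ y, ‖f y‖ ≤ C) → ∀ y,
      ‖q y * (E y * f y)‖ ≤ C * (m y * E y) := by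
    intro f C hf y
    rw [norm_mul, norm_mul, norm_real, Real.norm_of_nonneg (hE0 y).le]
    have : ‖q y‖ ≤ m y := by simp [hm]
    calc ‖q y‖ * (E y * ‖f y‖) ≤ m y * (E y * C) := by
          have := hE0 y
          gcongr
          exact hf y
      _ = _ := by ring
  have hb2 : ∀ (f : ℝ → ℂ) (C : ℝ), (∀ y, ‖f y‖ ≤ C) → ∀ y,
      ‖p y * (E y * f y)‖ ≤ C * (m y * E y) := by
    intro f C hf y
    rw [norm_mul, norm_mul, norm_real, Real.norm_of_nonneg (hE0 y).le]
    have : ‖p y‖ ≤ m y := by simp [hm]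
    calc ‖p y‖ * (E y * ‖f y‖) ≤ m y * (E y * C) := by
          have := hE0 y
          gcongr
          exact hf y
      _ = _ := by ring
  -- The fixed point has norm at most 2, from `‖F‖ ≤ 1 + ‖F‖/2`; removing the weight costs at most
  -- `E₀`.
  refine ⟨2 * E₀, by positivity, fun l hl => ?_⟩
  have h00 : (0 : ℝ) ≤ (0 : ℂ).im := by simp
  have hG1 : ∀ (G : BoundedContinuousFunction ℝ (ℂ × ℂ)) (y : ℝ), ‖(G y).1‖ ≤ ‖G‖ :=
    fun G y => (norm_fst_le _).trans (G.norm_coe_le_norm y)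
  have hG2 : ∀ (G : BoundedContinuousFunction ℝ (ℂ × ℂ)) (y : ℝ), ‖(G y).2‖ ≤ ‖G‖ :=
    fun G y => (norm_snd_le _).trans (G.norm_coe_le_norm y)
  set h1 : BoundedContinuousFunction ℝ (ℂ × ℂ) → ℝ → ℂ := fun G y => q y * (E y * (G y).2) with hh1
  set h2 : BoundedContinuousFunction ℝ (ℂ × ℂ) → ℝ → ℂ := fun G y => p y * (E y * (G y).1) with hh2
  have hc1 : ∀ G, Continuous (h1 G) := fun G => by
    have := G.continuous; fun_prop
  have hc2 : ∀ G, Continuous (h2 G) := fun G => by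
    have := G.continuous; fun_prop
  have hi1 : ∀ G, Integrable (h1 G) := fun G => hosci _ _ (hc1 G) (hb1 _ _ (hG2 G))
  have hi2 : ∀ G, Integrable (h2 G) := fun G => hosci _ _ (hc2 G) (hb2 _ _ (hG1 G))
  -- The unknown is `G = (u, w)/E`, so the weighted norm becomes the ordinary sup norm.
  set S : BoundedContinuousFunction ℝ (ℂ × ℂ) → ℝ → ℂ × ℂ := fun G x =>
    (E x)⁻¹ • (-oscTail l (h1 G) x, 1 - oscTail 0 (h2 G) x) with hS
  have hSc : ∀ G, Continuous (S G) := fun G => by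
    have a := continuous_oscTail hl (hc1 G) (hi1 G)
    have b := continuous_oscTail h00 (hc2 G) (hi2 G)
    have c : Continuous fun x => (E x)⁻¹ := hEc.inv₀ fun x => (hE0 x).ne'
    fun_prop
  have hscale : ∀ (x C : ℝ) (a b : ℂ), ‖a‖ ≤ C * E x → ‖b‖ ≤ C * E x →
      ‖(E x)⁻¹ • (a, b)‖ ≤ C := by
    intro x C a b ha hb
    rw [norm_smul, norm_inv, Real.norm_of_nonneg (hE0 x).le, inv_mul_le_iff₀ (hE0 x), mul_comm]
    exact max_le ha hb
  have hSb : ∀ G x, ‖S G x‖ ≤ 1 + ‖G‖ / 2 := by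
    intro G x
    have a := hosc l hl (h1 G) ‖G‖ (norm_nonneg _) (hb1 _ _ (hG2 G)) x
    have b := hosc 0 h00 (h2 G) ‖G‖ (norm_nonneg _) (hb2 _ _ (hG1 G)) x
    refine hscale x _ _ _ ?_ ?_
    · rw [norm_neg]; linarith [hE1 x]
    · refine (norm_sub_le _ _).trans ?_
      rw [norm_one]; linarith [hE1 x]
  set T : BoundedContinuousFunction ℝ (ℂ × ℂ) → BoundedContinuousFunction ℝ (ℂ × ℂ) := fun G =>
    BoundedContinuousFunction.ofNormedAddCommGroup (S G) (hSc G) _ (hSb G) with hT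
  have hcon : ContractingWith (1 / 2) T := by
    refine ⟨by rw [div_lt_one (by norm_num)]; norm_num, LipschitzWith.of_dist_le_mul fun G G' => ?_⟩
    rw [dist_eq_norm, dist_eq_norm]
    refine (BoundedContinuousFunction.norm_le (by positivity)).2 fun x => ?_
    have e : (T G - T G') x = (E x)⁻¹ • (-oscTail l (h1 (G - G')) x, -oscTail 0 (h2 (G - G')) x) := by
      have e1 := oscTail_sub hl (hi1 G) (hi1 G') x
      have e2 := oscTail_sub h00 (hi2 G) (hi2 G') x
      have f1 : (fun y => h1 G y - h1 G' y) = h1 (G - G') := by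
        funext y; simp only [hh1, BoundedContinuousFunction.sub_apply, Prod.snd_sub]; ring
      have f2 : (fun y => h2 G y - h2 G' y) = h2 (G - G') := by
        funext y; simp only [hh2, BoundedContinuousFunction.sub_apply, Prod.fst_sub]; ring
      rw [f1] at e1
      rw [f2] at e2
      rw [← e1, ← e2]
      change S G x - S G' x = _
      simp only [hS]
      rw [← smul_sub, Prod.mk_sub_mk]
      congr 2 <;> ring
    rw [e]
    refine hscale x _ _ _ ?_ ?_
    · rw [norm_neg]
      refine (hosc l hl _ _ (norm_nonneg (G - G')) (hb1 _ _ (hG2 _)) x).trans (le_of_eq ?_)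
      simp only [NNReal.coe_div, NNReal.coe_one, NNReal.coe_ofNat]; ring
    · rw [norm_neg]
      refine (hosc 0 h00 _ _ (norm_nonneg (G - G')) (hb2 _ _ (hG1 _)) x).trans (le_of_eq ?_)
      simp only [NNReal.coe_div, NNReal.coe_one, NNReal.coe_ofNat]; ring
  obtain ⟨F, hF⟩ : ∃ F, F = hcon.fixedPoint := ⟨_, rfl⟩
  have hFT : T F = F := hF ▸ hcon.fixedPoint_isFixedPt
  have hFn : ‖F‖ ≤ 2 := by
    have h0 : ‖T F‖ ≤ 1 + ‖F‖ / 2 :=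
      (BoundedContinuousFunction.norm_le (by positivity)).2 (hSb F)
    rw [hFT] at h0
    linarith
  have hFx : ∀ x, (E x) • F x = (-oscTail l (h1 F) x, 1 - oscTail 0 (h2 F) x) := by
    intro x
    have : F x = S F x := by
      conv_lhs => rw [← hFT]
      rfl
    rw [this]
    simp only [hS]
    rw [smul_inv_smul₀ (hE0 x).ne']
  have hFb : ∀ x (z : ℂ), ‖z‖ ≤ ‖F‖ → ‖(E x : ℂ) * z‖ ≤ 2 * E₀ := by
    intro x z hz
    rw [norm_mul, norm_real, Real.norm_of_nonneg (hE0 x).le, mul_comm]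
    exact mul_le_mul (hz.trans hFn) (hEb x) (hE0 x).le (by norm_num)
  have hFc := F.continuous
  refine ⟨fun x => E x * (F x).1, fun x => E x * (F x).2, by fun_prop, by fun_prop,
    fun x => hFb x _ (hG1 F x), fun x => hFb x _ (hG2 F x), fun x => ?_, fun x => ?_⟩
  · have := congrArg Prod.fst (hFx x)
    simpa using this
  · have := congrArg Prod.snd (hFx x)
    simpa using this

/-! ### Expansion of the Volterra solution in `1/λ`. -/

theorem SchwartzMap.exists_norm_le (f : 𝓢(ℝ, ℂ)) : ∃ B : ℝ, 0 ≤ B ∧ ∀ x, ‖f x‖ ≤ B :=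
  ⟨_, norm_nonneg _, fun x => f.toBoundedContinuousFunction.norm_coe_le_norm x⟩

/-- Differential form of the Volterra system. -/
theorem hasDerivAt_of_volterra {q p u w : ℝ → ℂ} (hqc : Continuous q) (hpc : Continuous p)
    (hqi : Integrable q) (hpi : Integrable p) {K : ℝ} {l : ℂ} (hl : 0 ≤ l.im)
    (huc : Continuous u) (hwc : Continuous w) (hu : ∀ x, ‖u x‖ ≤ K) (hw : ∀ x, ‖w x‖ ≤ K)
    (hue : ∀ x, u x = -oscTail l (fun y => q y * w y) x)
    (hwe : ∀ x, w x = 1 - oscTail 0 (fun y => p y * u y) x) (x : ℝ) :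
    HasDerivAt u (-2 * I * l * u x + q x * w x) x ∧ HasDerivAt w (p x * u x) x := by
  have i1 : Integrable fun y => q y * w y :=
    hqi.mul_bdd hwc.aestronglyMeasurable (Eventually.of_forall hw)
  have i2 : Integrable fun y => p y * u y :=
    hpi.mul_bdd huc.aestronglyMeasurable (Eventually.of_forall hu)
  have d1 := (hasDerivAt_oscTail hl (h := fun y => q y * w y) (hqc.mul hwc) i1 x).neg
  have d2 := (hasDerivAt_oscTail (l := 0) (h := fun y => p y * u y) (by simp) (hpc.mul huc) i2 x).const_sub 1
  constructor
  · have : u = -oscTail l (fun y => q y * w y) := funext hue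
    rw [hue x]
    rw [← this] at d1
    convert! d1 using 1
    ring
  · have : w = fun x => 1 - oscTail 0 (fun y => p y * u y) x := funext hwe
    rw [← this] at d2
    convert! d2 using 1
    ring

theorem norm_div_two_I_mul_le {a l : ℂ} {C : ℝ} (h : ‖a‖ ≤ C) : ‖a / (2 * I * l)‖ ≤ C / 2 / ‖l‖ := by
  rw [norm_div, norm_mul, norm_mul, norm_I, mul_one, Complex.norm_ofNat, div_div]
  gcongr

/-- A bootstrap: each integration by parts gains a factor `1/l`, at the cost of a derivative of `q`
and of `w' = p u`. The constant depends on neither `l` nor `x`, which permits integrating the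
estimate for `u` to obtain the one for `w`. -/
theorem volterra_expansion (q : 𝓢(ℝ, ℂ)) {p : ℝ → ℂ} (hpc : Continuous p) (hpi : Integrable p)
    {K : ℝ} (hK : 0 ≤ K) :
    ∃ C : ℝ, ∀ l : ℂ, 0 ≤ l.im → l ≠ 0 → ∀ u w : ℝ → ℂ, Continuous u → Continuous w →
      (∀ x, ‖u x‖ ≤ K) → (∀ x, ‖w x‖ ≤ K) →
      (∀ x, u x = -oscTail l (fun y => q y * w y) x) →
      (∀ x, w x = 1 - oscTail 0 (fun y => p y * u y) x) →
      ∀ x, ‖u x - q x / (2 * I * l)‖ ≤ C / ‖l‖ ^ 2 ∧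
        ‖w x - (1 - 1 / (2 * I * l) * ∫ y in Ioi x, q y * p y)‖ ≤ C / ‖l‖ ^ 2 := by
  set P := ∫ y, ‖p y‖ with hP
  have hP0 : 0 ≤ P := integral_nonneg fun _ => norm_nonneg _
  -- Stated for a general `f` because it is needed twice: `f = q` gives `u = O(1/l)`, and `f = q'`
  -- controls the remainder of the first integration by parts.
  have key : ∀ f : 𝓢(ℝ, ℂ), ∃ D : ℝ, 0 ≤ D ∧ ∀ l : ℂ, 0 ≤ l.im → l ≠ 0 → ∀ u w : ℝ → ℂ,
      Continuous u → Continuous w → (∀ x, ‖u x‖ ≤ K) → (∀ x, ‖w x‖ ≤ K) →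
      (∀ x, HasDerivAt w (p x * u x) x) →
      ∀ x, Integrable (fun y => f y * (p y * u y)) ∧
        Integrable (fun y => deriv f y * w y) ∧
        oscTail l (fun y => f y * w y) x = -(f x * w x +
          oscTail l (fun y => deriv f y * w y + f y * (p y * u y)) x) / (2 * I * l) ∧
        ‖oscTail l (fun y => f y * w y) x‖ ≤ D / ‖l‖ := by
    intro f
    obtain ⟨B, hB0, hB⟩ := f.exists_norm_le
    have hfi : Integrable (fun y => deriv f y) := (SchwartzMap.derivCLM ℝ ℂ f).integrable
    refine ⟨(K * B + ∫ y, (‖deriv f y‖ * K + B * (‖p y‖ * K))) / 2, ?_, ?_⟩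
    · have : 0 ≤ ∫ y, (‖deriv f y‖ * K + B * (‖p y‖ * K)) :=
        integral_nonneg fun y => by positivity
      positivity
    intro l hl hl0 u w huc hwc hu hw hwd x
    have i1 : Integrable fun y => f y * w y :=
      f.integrable.mul_bdd hwc.aestronglyMeasurable (Eventually.of_forall hw)
    have i2 : Integrable fun y => p y * u y :=
      hpi.mul_bdd huc.aestronglyMeasurable (Eventually.of_forall hu)
    have i3 : Integrable fun y => f y * (p y * u y) :=
      i2.bdd_mul f.continuous.aestronglyMeasurable (Eventually.of_forall hB)
    have i4 : Integrable fun y => deriv f y * w y :=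
      hfi.mul_bdd hwc.aestronglyMeasurable (Eventually.of_forall hw)
    have parts := oscTail_by_parts hl hl0 (h := fun y => f y * w y)
      (h' := fun y => deriv f y * w y + f y * (p y * u y))
      (fun y => (f.hasDerivAt y).mul (hwd y)) i1 (i4.add i3) x
    refine ⟨i3, i4, parts, ?_⟩
    rw [parts]
    refine norm_div_two_I_mul_le ?_
    rw [norm_neg]
    refine (norm_add_le _ _).trans (add_le_add ?_ ?_)
    · rw [norm_mul, mul_comm]
      exact mul_le_mul (hw x) (hB x) (norm_nonneg _) hK
    · refine norm_oscTail_le_integral hl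
        ((hfi.norm.mul_const K).add ((hpi.norm.mul_const K).const_mul B)) (fun y => ?_) x
      refine (norm_add_le _ _).trans ?_
      rw [norm_mul, norm_mul, norm_mul]
      change _ ≤ ‖deriv f y‖ * K + B * (‖p y‖ * K)
      gcongr
      exacts [hw y, hB y, hu y]
  obtain ⟨D, hD0, hD⟩ := key q
  obtain ⟨D₁, hD₁0, hD₁⟩ := key (SchwartzMap.derivCLM ℝ ℂ q)
  obtain ⟨B, hB0, hB⟩ := q.exists_norm_le
  set C := (B * (P * D) + (D₁ + B * (P * D))) / 2 with hC
  have hC0 : 0 ≤ C := by positivity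
  refine ⟨C * (1 + P), fun l hl hl0 u w huc hwc hu hw hue hwe => ?_⟩
  have hln : 0 < ‖l‖ := norm_pos_iff.2 hl0
  have hwd : ∀ x, HasDerivAt w (p x * u x) x := fun x =>
    (hasDerivAt_of_volterra q.continuous hpc q.integrable hpi hl huc hwc hu hw hue hwe x).2
  have hpu : ∀ y, ‖p y * u y‖ ≤ ‖p y‖ * (D / ‖l‖) := by
    intro y
    rw [norm_mul, hue y, norm_neg]
    gcongr
    exact (hD l hl hl0 u w huc hwc hu hw hwd y).2.2.2
  have hw1 : ∀ x, ‖w x - 1‖ ≤ P * (D / ‖l‖) := by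
    intro x
    have := norm_oscTail_le_integral (l := 0) (by simp) (hpi.norm.mul_const (D / ‖l‖)) hpu x
    rw [integral_mul_const] at this
    rwa [hwe x, sub_sub_cancel_left, norm_neg]
  have hu1 : ∀ x, ‖u x - q x / (2 * I * l)‖ ≤ C / ‖l‖ ^ 2 := by
    intro x
    obtain ⟨i3, i4, parts, -⟩ := hD l hl hl0 u w huc hwc hu hw hwd x
    have b1 := (hD₁ l hl hl0 u w huc hwc hu hw hwd x).2.2.2
    simp only [SchwartzMap.derivCLM_apply] at b1
    have b2 : ‖oscTail l (fun y => q y * (p y * u y)) x‖ ≤ B * (P * (D / ‖l‖)) := by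
      have := norm_oscTail_le_integral hl ((hpi.norm.mul_const (D / ‖l‖)).const_mul B)
        (h := fun y => q y * (p y * u y)) (fun y => by
          rw [norm_mul]
          exact mul_le_mul (hB y) (hpu y) (norm_nonneg _) hB0) x
      rwa [integral_const_mul, integral_mul_const] at this
    have split := oscTail_sub hl (i4.add i3) i4 x
    simp only [Pi.add_apply, add_sub_cancel_left] at split
    -- After one integration by parts the leading term is `q w/(2il)`. Replacing `w` by 1 leaves
    -- three terms, each `O(1/l)` before the division by `2il`.
    have e : u x - q x / (2 * I * l) = (q x * (w x - 1) + (oscTail l (fun y => deriv q y * w y) x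
        + oscTail l (fun y => q y * (p y * u y)) x)) / (2 * I * l) := by
      rw [hue x, parts, ← split]
      simp only [Pi.add_def]
      ring
    rw [e]
    have b : ‖q x * (w x - 1) + (oscTail l (fun y => deriv q y * w y) x
        + oscTail l (fun y => q y * (p y * u y)) x)‖ ≤
        B * (P * (D / ‖l‖)) + (D₁ / ‖l‖ + B * (P * (D / ‖l‖))) := by
      refine (norm_add_le _ _).trans (add_le_add ?_ ((norm_add_le _ _).trans (add_le_add b1 b2)))
      rw [norm_mul]
      exact mul_le_mul (hB x) (hw1 x) (norm_nonneg _) hB0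
    refine (norm_div_two_I_mul_le b).trans (le_of_eq ?_)
    rw [hC]
    field_simp
  intro x
  constructor
  · refine (hu1 x).trans ?_
    gcongr
    nlinarith
  · have i2 : Integrable fun y => p y * u y :=
      hpi.mul_bdd huc.aestronglyMeasurable (Eventually.of_forall hu)
    have i5 : Integrable fun y => q y * p y :=
      hpi.bdd_mul q.continuous.aestronglyMeasurable (Eventually.of_forall hB)
    have h0 : (0 : ℝ) ≤ (0 : ℂ).im := by simp
    have e : w x - (1 - 1 / (2 * I * l) * ∫ y in Ioi x, q y * p y) =
        -oscTail 0 (fun y => p y * (u y - q y / (2 * I * l))) x := by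
      have s := oscTail_sub h0 i2 (i5.const_mul (1 / (2 * I * l))) x
      have s2 : oscTail 0 (fun y => 1 / (2 * I * l) * (q y * p y)) x =
          1 / (2 * I * l) * ∫ y in Ioi x, q y * p y := by
        simp only [oscTail, mul_zero, zero_mul, exp_zero, one_mul]
        rw [integral_const_mul]
      rw [s2] at s
      rw [hwe x]
      have : (fun y => p y * (u y - q y / (2 * I * l))) =
          fun y => p y * u y - 1 / (2 * I * l) * (q y * p y) := by
        funext y; ring
      rw [this, ← s]
      ring
    rw [e, norm_neg]
    have := norm_oscTail_le_integral h0 (hpi.norm.mul_const (C / ‖l‖ ^ 2))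
      (h := fun y => p y * (u y - q y / (2 * I * l))) (fun y => by
        rw [norm_mul]
        exact mul_le_mul_of_nonneg_left (hu1 y) (norm_nonneg _)) x
    rw [integral_mul_const] at this
    refine this.trans ?_
    rw [← mul_div_assoc]
    exact div_le_div_of_nonneg_right (by nlinarith) (by positivity)

/-! ### The Jost solution `ψ`: existence and expansion. -/

theorem coeffMatrix_mulVec (q r : 𝓢(ℝ, ℂ)) (ζ : ℂ) (x : ℝ) (v : Fin 2 → ℂ) :
    coeffMatrix q r ζ x *ᵥ v =
      ![(-I * ζ ^ 2 - I / 2 * q x * r x) * v 0 + ζ * q x * v 1,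
        ζ * r x * v 0 + (I * ζ ^ 2 + I / 2 * q x * r x) * v 1] := by
  ext i
  fin_cases i <;> simp [coeffMatrix, Matrix.mulVec, dotProduct, Fin.sum_univ_two]

theorem isSolution_iff {q r : 𝓢(ℝ, ℂ)} {ζ : ℂ} {f : ℝ → Fin 2 → ℂ} :
    IsSolution q r ζ f ↔ ∀ x,
      HasDerivAt (fun x => f x 0)
        ((-I * ζ ^ 2 - I / 2 * q x * r x) * f x 0 + ζ * q x * f x 1) x ∧
      HasDerivAt (fun x => f x 1)
        (ζ * r x * f x 0 + (I * ζ ^ 2 + I / 2 * q x * r x) * f x 1) x := by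
  unfold IsSolution
  refine forall_congr' fun x => ?_
  rw [hasDerivAt_pi, Fin.forall_fin_two, coeffMatrix_mulVec]
  simp

theorem norm_exp_I_mul_le_one {l : ℂ} (hl : 0 ≤ l.im) {x : ℝ} (hx : 0 ≤ x) :
    ‖exp (I * l * x)‖ ≤ 1 := by
  rw [norm_exp, Real.exp_le_one_iff]
  have : (I * l * x).re = -(l.im * x) := by simp
  rw [this]
  have := mul_nonneg hl hx
  linarith

theorem hasDerivAt_exp_I_mul (l : ℂ) (x : ℝ) :
    HasDerivAt (fun t : ℝ => exp (I * l * t)) (exp (I * l * x) * (I * l)) x := by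
  simpa using ((hasDerivAt_id (x : ℂ)).comp_ofReal.const_mul (I * l)).cexp

/-- Existence of the Jost solution `ψ`, with an expansion uniform in the spectral parameter. -/
theorem exists_isJostPsi_expansion (q r : 𝓢(ℝ, ℂ)) :
    ∃ C : ℝ, ∀ ζ : ℂ, 0 ≤ (ζ ^ 2).im → ∃ u v : ℝ → ℂ,
      IsJostPsi q r ζ
        (fun x : ℝ => ![ζ * (exp (I * ζ ^ 2 * x) * u x), exp (I * ζ ^ 2 * x) * v x]) ∧
      (ζ ≠ 0 → ∀ x, ‖u x - q x / (2 * I * ζ ^ 2)‖ ≤ C / ‖ζ ^ 2‖ ^ 2 ∧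
        ‖v x - (1 + q x * r x / (4 * ζ ^ 2)
          - 1 / (2 * I * ζ ^ 2) * ∫ y in Ioi x, sigma q r y)‖ ≤ (1 + ‖r x‖) * (C / ‖ζ ^ 2‖ ^ 2)) := by
  obtain ⟨Bq, hBq0, hBq⟩ := q.exists_norm_le
  obtain ⟨Br, hBr0, hBr⟩ := r.exists_norm_le
  -- The choice of `p` is forced by the substitution `v = w + (i/2) r u`: the derivative of the
  -- correction cancels the term `ζ² r u` in the equation for `v`.
  set p : ℝ → ℂ := fun x => -(I / 2 * deriv r x + (1 / 4 * q x * r x) * r x) with hp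
  have hr'c : Continuous (deriv r) := (SchwartzMap.derivCLM ℝ ℂ r).continuous
  have hr'i : Integrable (fun y => deriv r y) := (SchwartzMap.derivCLM ℝ ℂ r).integrable
  have hqc := q.continuous
  have hrc := r.continuous
  have hpc : Continuous p := by fun_prop
  have hpi : Integrable p := by
    refine ((hr'i.const_mul _).add
      (r.integrable.bdd_mul (c := 1 / 4 * Bq * Br) (by fun_prop) (Eventually.of_forall fun x => ?_))).neg
    rw [norm_mul, norm_mul]
    have : ‖(1 / 4 : ℂ)‖ = 1 / 4 := by norm_num
    rw [this]
    gcongr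
    exacts [hBq x, hBr x]
  have hσ : ∀ y, q y * p y = sigma q r y := fun y => by
    simp only [hp, sigma]; ring
  obtain ⟨K, hK, hsol⟩ := exists_volterra_solution hqc hpc q.integrable hpi
  obtain ⟨C, hC⟩ := volterra_expansion q hpc hpi hK
  refine ⟨C, fun ζ hζ => ?_⟩
  obtain ⟨u, w, huc, hwc, hu, hw, hue, hwe⟩ := hsol (ζ ^ 2) hζ
  have hd := hasDerivAt_of_volterra hqc hpc q.integrable hpi hζ huc hwc hu hw hue hwe
  have hut : Tendsto u atTop (𝓝 0) := by
    have := (tendsto_oscTail hζ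
      (q.integrable.mul_bdd hwc.aestronglyMeasurable (Eventually.of_forall hw))).neg
    rw [neg_zero] at this
    exact this.congr fun x => (hue x).symm
  have hwt : Tendsto w atTop (𝓝 1) := by
    have := (tendsto_oscTail (l := 0) (by simp)
      (hpi.mul_bdd huc.aestronglyMeasurable (Eventually.of_forall hu))).const_sub 1
    rw [sub_zero] at this
    exact this.congr fun x => (hwe x).symm
  have hrt : Tendsto (fun x => I / 2 * r x * u x) atTop (𝓝 0) := by
    refine squeeze_zero_norm (a := fun x => 1 / 2 * Br * ‖u x‖) (fun x => ?_) ?_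
    · rw [norm_mul, norm_mul]
      have : ‖I / 2‖ = 1 / 2 := by simp
      rw [this]
      gcongr
      exact hBr x
    · simpa using hut.norm.const_mul (1 / 2 * Br)
  refine ⟨u, fun x => w x + I / 2 * r x * u x, ⟨?_, ?_, ?_⟩, fun hζ0 x => ?_⟩
  · rw [isSolution_iff]
    intro x
    obtain ⟨d1, d2⟩ := hd x
    have de := hasDerivAt_exp_I_mul (ζ ^ 2) x
    simp only [Matrix.cons_val_zero, Matrix.cons_val_one]
    constructor
    · convert! (de.mul d1).const_mul ζ using 1
      ring
    · convert! de.mul (d2.add (((r.hasDerivAt x).const_mul (I / 2)).mul d1)) using 1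
      simp only [hp, Pi.mul_apply, Pi.add_apply]
      linear_combination (exp (I * ζ ^ 2 * x) * (ζ ^ 2 * r x * u x + 1 / 4 * q x * r x ^ 2 * u x)) * I_sq
  · simp only [Matrix.cons_val_zero]
    refine squeeze_zero_norm' (a := fun x => ‖ζ‖ * ‖u x‖) ?_ ?_
    · filter_upwards [eventually_ge_atTop 0] with x hx
      rw [norm_mul, norm_mul]
      gcongr
      exact mul_le_of_le_one_left (norm_nonneg _) (norm_exp_I_mul_le_one hζ hx)
    · simpa using hut.norm.const_mul ‖ζ‖
  · simp only [Matrix.cons_val_one]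
    have := hwt.add hrt
    rw [add_zero] at this
    refine this.congr fun x => ?_
    simp only [Matrix.cons_val_fin_one]
    rw [mul_div_cancel_left₀ _ (exp_ne_zero _)]
  · obtain ⟨c1, c2⟩ := hC (ζ ^ 2) hζ (pow_ne_zero 2 hζ0) u w huc hwc hu hw hue hwe x
    simp only [hσ] at c2
    refine ⟨c1, ?_⟩
    -- Inserting `u ≈ q/(2iλ)` into `(i/2) r u` produces `qr/(4λ)`; the error there is what brings
    -- `‖r x‖` into the bound.
    have e : w x + I / 2 * r x * u x - (1 + q x * r x / (4 * ζ ^ 2)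
          - 1 / (2 * I * ζ ^ 2) * ∫ y in Ioi x, sigma q r y) =
        (w x - (1 - 1 / (2 * I * ζ ^ 2) * ∫ y in Ioi x, sigma q r y)) +
          I / 2 * (r x * (u x - q x / (2 * I * ζ ^ 2))) := by
      have : I / 2 * (r x * (q x / (2 * I * ζ ^ 2))) = q x * r x / (4 * ζ ^ 2) := by
        field_simp
        ring
      linear_combination this
    rw [e]
    refine (norm_add_le _ _).trans ?_
    rw [norm_mul, norm_mul, add_mul, one_mul]
    refine add_le_add c2 ?_
    have : ‖I / 2‖ = 1 / 2 := by simp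
    rw [this]
    have := mul_le_mul_of_nonneg_left c1 (norm_nonneg (r x))
    have : 0 ≤ ‖r x‖ * ‖u x - q x / (2 * I * ζ ^ 2)‖ := by positivity
    linarith

/-! ### Uniqueness of `ψ`. -/

theorem exists_lipschitzWith_coeffMatrix (q r : 𝓢(ℝ, ℂ)) (ζ : ℂ) :
    ∃ K : NNReal, ∀ x, LipschitzWith K fun v : Fin 2 → ℂ => coeffMatrix q r ζ x *ᵥ v := by
  obtain ⟨Bq, hBq0, hBq⟩ := q.exists_norm_le
  obtain ⟨Br, hBr0, hBr⟩ := r.exists_norm_le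
  set L : ℝ := ‖ζ ^ 2‖ + 1 / 2 * Bq * Br + ‖ζ‖ * (Bq + Br) with hL
  have hL0 : 0 ≤ L := by positivity
  refine ⟨⟨L, hL0⟩, fun x => LipschitzWith.of_dist_le_mul fun v w => ?_⟩
  rw [dist_eq_norm, dist_eq_norm, ← Matrix.mulVec_sub, coeffMatrix_mulVec]
  set z := v - w
  have z0 : ‖z 0‖ ≤ ‖z‖ := norm_le_pi_norm z 0
  have z1 : ‖z 1‖ ≤ ‖z‖ := norm_le_pi_norm z 1
  have hI : ‖I / 2‖ = 1 / 2 := by simp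
  have ha : ‖I / 2 * q x * r x‖ ≤ 1 / 2 * Bq * Br := by
    rw [norm_mul, norm_mul, hI]
    gcongr
    exacts [hBq x, hBr x]
  have hd1 : ‖-I * ζ ^ 2 - I / 2 * q x * r x‖ ≤ ‖ζ ^ 2‖ + 1 / 2 * Bq * Br :=
    (norm_sub_le _ _).trans (add_le_add (by simp) ha)
  have hd2 : ‖I * ζ ^ 2 + I / 2 * q x * r x‖ ≤ ‖ζ ^ 2‖ + 1 / 2 * Bq * Br :=
    (norm_add_le _ _).trans (add_le_add (by simp) ha)
  have ho1 : ‖ζ * q x‖ ≤ ‖ζ‖ * (Bq + Br) := by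
    rw [norm_mul]; gcongr; linarith [hBq x]
  have ho2 : ‖ζ * r x‖ ≤ ‖ζ‖ * (Bq + Br) := by
    rw [norm_mul]; gcongr; linarith [hBr x]
  have hbound : ∀ a b : ℂ, ∀ A B : ℝ, ‖a‖ ≤ A → ‖b‖ ≤ B → ‖a * z 0 + b * z 1‖ ≤ (A + B) * ‖z‖ := by
    intro a b A B ha hb
    refine (norm_add_le _ _).trans ?_
    rw [norm_mul, norm_mul, add_mul]
    exact add_le_add (mul_le_mul ha z0 (norm_nonneg _) ((norm_nonneg _).trans ha))
      (mul_le_mul hb z1 (norm_nonneg _) ((norm_nonneg _).trans hb))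
  refine (pi_norm_le_iff_of_nonneg (by positivity)).2 fun i => ?_
  change _ ≤ L * ‖z‖
  fin_cases i
  · exact hbound _ _ _ _ hd1 ho1
  · exact (hbound _ _ _ _ ho2 hd2).trans_eq (by rw [add_comm])

/-- The coefficient matrix has trace zero, so the Wronskian of two candidates is constant; it tends
to 0 at `+∞`, so the candidates are proportional at a point and, by ODE uniqueness, everywhere. The
normalisation at `+∞` fixes the ratio to be 1. -/
theorem IsJostPsi.unique {q r : 𝓢(ℝ, ℂ)} {ζ : ℂ} (hζ : 0 ≤ (ζ ^ 2).im) {f g : ℝ → Fin 2 → ℂ}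
    (hf : IsJostPsi q r ζ f) (hg : IsJostPsi q r ζ g) : f = g := by
  have sf := isSolution_iff.1 hf.solution
  have sg := isSolution_iff.1 hg.solution
  have hWd : ∀ x, HasDerivAt (fun x => g x 0 * f x 1 - f x 0 * g x 1) 0 x := by
    intro x
    convert! ((sg x).1.mul (sf x).2).sub ((sf x).1.mul (sg x).2) using 1
    ring
  -- For `x ≥ 0`, `|e^{iλx}| ≤ 1`, so dividing the second component by the exponential only
  -- increases it.
  have bounded : ∀ {h : ℝ → Fin 2 → ℂ}, IsJostPsi q r ζ h → ∀ {k : ℝ → ℂ},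
      Tendsto k atTop (𝓝 0) → Tendsto (fun x => k x * h x 1) atTop (𝓝 0) := by
    intro h hh k hk
    have := (hk.mul hh.snd).norm
    rw [zero_mul, norm_zero] at this
    refine squeeze_zero_norm' ?_ this
    filter_upwards [eventually_ge_atTop 0] with x hx
    rw [norm_mul, norm_mul, norm_div]
    gcongr
    exact le_div_self (norm_nonneg _) (norm_pos_iff.2 (exp_ne_zero _))
      (norm_exp_I_mul_le_one hζ hx)
  have hW : ∀ x, g x 0 * f x 1 - f x 0 * g x 1 = 0 := by
    intro x
    have hconst : ∀ y, g y 0 * f y 1 - f y 0 * g y 1 = g x 0 * f x 1 - f x 0 * g x 1 := fun y =>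
      is_const_of_deriv_eq_zero (fun t => (hWd t).differentiableAt) (fun t => (hWd t).deriv) y x
    have ht := (bounded hf hg.fst).sub (bounded hg hf.fst)
    rw [sub_zero] at ht
    exact tendsto_nhds_unique (tendsto_const_nhds.congr fun y => (hconst y).symm) ht
  have hratio : Tendsto (fun x => f x 1 / g x 1) atTop (𝓝 1) := by
    have := hf.snd.div hg.snd one_ne_zero
    rw [div_one] at this
    exact this.congr fun x => div_div_div_cancel_right₀ (exp_ne_zero _) _ _
  obtain ⟨x₀, hx₀⟩ := (hratio.eventually_ne one_ne_zero).exists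
  -- Division by zero yields 0, so a nonzero quotient already certifies a nonzero denominator.
  have hg0 : g x₀ 1 ≠ 0 := fun h => hx₀ (by rw [h, div_zero])
  set c := f x₀ 1 / g x₀ 1 with hc
  obtain ⟨K, hK⟩ := exists_lipschitzWith_coeffMatrix q r ζ
  have hfg : f = c • g := by
    refine ODE_solution_unique_univ (s := fun _ => univ) (t₀ := x₀)
      (v := fun x v => coeffMatrix q r ζ x *ᵥ v) (K := K) (fun t => (hK t).lipschitzOnWith)
      (fun t => ⟨hf.solution t, mem_univ _⟩) (fun t => ⟨?_, mem_univ _⟩) ?_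
    · have := (hg.solution t).const_smul c
      rwa [← Matrix.mulVec_smul] at this
    · ext i
      fin_cases i
      · change f x₀ 0 = f x₀ 1 / g x₀ 1 * g x₀ 0
        rw [div_mul_eq_mul_div, eq_div_iff hg0]
        linear_combination -hW x₀
      · change f x₀ 1 = f x₀ 1 / g x₀ 1 * g x₀ 1
        rw [div_mul_cancel₀ _ hg0]
  have hc1 : c = 1 := by
    have h1 : Tendsto (fun x : ℝ => f x 1 / exp (I * ζ ^ 2 * x)) atTop (𝓝 (c * 1)) := by
      refine (hg.snd.const_mul c).congr fun x => ?_
      rw [hfg]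
      change _ = c * g x 1 / _
      rw [mul_div_assoc]
    have := tendsto_nhds_unique h1 hf.snd
    rwa [mul_one] at this
  rw [hfg, hc1, one_smul]

theorem existsUnique_isJostPsi (q r : 𝓢(ℝ, ℂ)) {ζ : ℂ} (hζ : 0 ≤ (ζ ^ 2).im) :
    ∃! f : ℝ → Fin 2 → ℂ, IsJostPsi q r ζ f := by
  obtain ⟨C, hC⟩ := exists_isJostPsi_expansion q r
  obtain ⟨u, v, h, -⟩ := hC ζ hζ
  exact ⟨_, h, fun g hg => hg.unique hζ h⟩

/-! ### Asymptotics of `ψ` as `λ → ∞`. -/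

theorem eventually_lamInfUpper : ∀ᶠ ζ in lamInfUpper, 0 ≤ (ζ ^ 2).im ∧ ζ ≠ 0 := by
  have h : ∀ᶠ l : ℂ in Bornology.cobounded ℂ ⊓ 𝓟 {l : ℂ | 0 ≤ l.im}, 0 ≤ l.im ∧ l ≠ 0 :=
    (eventually_inf_principal.2 (Eventually.of_forall fun _ h => h)).and
      ((Bornology.eventually_ne_cobounded 0).filter_mono inf_le_left)
  filter_upwards [tendsto_comap.eventually h] with ζ hζ
  exact ⟨hζ.1, fun h => hζ.2 (by rw [h]; simp)⟩

theorem ExpBracket.of_norm_sub_le {s : ℂ} {x : ℝ} {F G k : ℂ → ℂ} {C : ℝ} {l : Filter ℂ}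
    (hF : ∀ᶠ ζ in l, F ζ = exp (s * I * ζ ^ 2 * x) * k ζ)
    (hk : ∀ᶠ ζ in l, ‖k ζ - G ζ‖ ≤ C / ‖ζ ^ 2‖ ^ 2) : ExpBracket l s x F G := by
  refine ⟨fun ζ => k ζ - G ζ, IsBigO.of_bound C ?_, ?_⟩
  · filter_upwards [hk] with ζ h
    refine h.trans_eq ?_
    rw [norm_div, norm_one, norm_pow (ζ ^ 2), mul_one_div]
  · filter_upwards [hF] with ζ h
    rw [h]
    ring

theorem expBracket_psi (q r : 𝓢(ℝ, ℂ)) {ψ : ℂ → ℝ → Fin 2 → ℂ}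
    (hψ : ∀ ζ : ℂ, 0 ≤ (ζ ^ 2).im → IsJostPsi q r ζ (ψ ζ)) (x : ℝ) :
    ExpBracket lamInfUpper 1 x (fun ζ => ψ ζ x 0 / ζ) (fun ζ => q x / (2 * I * ζ ^ 2)) ∧
    ExpBracket lamInfUpper 1 x (fun ζ => ψ ζ x 1)
      (fun ζ => 1 + q x * r x / (4 * ζ ^ 2)
        - 1 / (2 * I * ζ ^ 2) * ∫ y in Ioi x, sigma q r y) := by
  obtain ⟨C, hC⟩ := exists_isJostPsi_expansion q r
  choose! u v h hexp using hC
  have heq : ∀ ζ : ℂ, 0 ≤ (ζ ^ 2).im → ψ ζ x =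
      ![ζ * (exp (I * ζ ^ 2 * x) * u ζ x), exp (I * ζ ^ 2 * x) * v ζ x] := fun ζ hζ =>
    congrFun ((hψ ζ hζ).unique hζ (h ζ hζ)) x
  refine ⟨ExpBracket.of_norm_sub_le (k := fun ζ => u ζ x) (C := C) ?_ ?_,
    ExpBracket.of_norm_sub_le (k := fun ζ => v ζ x) (C := (1 + ‖r x‖) * C) ?_ ?_⟩
  · filter_upwards [eventually_lamInfUpper] with ζ ⟨hζ, hζ0⟩
    rw [heq ζ hζ]
    simp only [Matrix.cons_val_zero]
    rw [mul_div_cancel_left₀ _ hζ0, one_mul]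
  · filter_upwards [eventually_lamInfUpper] with ζ ⟨hζ, hζ0⟩
    exact (hexp ζ hζ hζ0 x).1
  · filter_upwards [eventually_lamInfUpper] with ζ ⟨hζ, hζ0⟩
    rw [heq ζ hζ, one_mul]
    simp
  · filter_upwards [eventually_lamInfUpper] with ζ ⟨hζ, hζ0⟩
    exact (hexp ζ hζ hζ0 x).2.trans_eq (mul_div_assoc _ _ _).symm

/-! ### Symmetries carrying the other Jost solutions to `ψ`. -/

/-- The reflection `x ↦ f (-x)` of a Schwartz function. -/
noncomputable def SchwartzMap.reflect (f : 𝓢(ℝ, ℂ)) : 𝓢(ℝ, ℂ) :=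
  SchwartzMap.compCLMOfContinuousLinearEquiv ℂ (ContinuousLinearEquiv.neg ℝ) f

theorem SchwartzMap.reflect_apply (f : 𝓢(ℝ, ℂ)) (x : ℝ) : f.reflect x = f (-x) := rfl

theorem SchwartzMap.deriv_reflect (f : 𝓢(ℝ, ℂ)) (x : ℝ) :
    deriv f.reflect x = -deriv f (-x) := deriv_comp_neg f x

theorem SchwartzMap.deriv_smul (c : ℂ) (f : 𝓢(ℝ, ℂ)) (x : ℝ) :
    deriv (c • f) x = c * deriv f x :=
  ((f.hasDerivAt x).const_mul c).deriv

theorem forall_hasDerivAt_comp_neg {f d : ℝ → ℂ} :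
    (∀ x, HasDerivAt (fun x => f (-x)) (-d (-x)) x) ↔ ∀ x, HasDerivAt f (d x) x := by
  have key : ∀ {f d : ℝ → ℂ}, (∀ x, HasDerivAt f (d x) x) → ∀ x,
      HasDerivAt (fun x => f (-x)) (-d (-x)) x := by
    intro f d h x
    convert! (h (-x)).scomp x (hasDerivAt_neg x) using 1
    simp
  refine ⟨fun h x => ?_, key⟩
  simpa using key (d := fun x => -d (-x)) h x

/-- Interchange of the two components. -/
def swapComponents (f : ℝ → Fin 2 → ℂ) : ℝ → Fin 2 → ℂ := fun x => ![f x 1, f x 0]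

/-- Reflection of the independent variable. -/
def reflectVar (f : ℝ → Fin 2 → ℂ) : ℝ → Fin 2 → ℂ := fun x => f (-x)

theorem swapComponents_involutive : Function.Involutive swapComponents := by
  intro f
  funext x i
  fin_cases i <;> rfl

theorem reflectVar_involutive : Function.Involutive reflectVar := by
  intro f
  funext x
  simp [reflectVar]

/-- Under `(q, r, ζ) ↦ (-ir, -iq, iζ)` both `λ` and `qr` change sign while `ζq` and `ζr` are
exchanged, which is conjugation of the coefficient matrix by the transposition. -/
theorem isSolution_swapComponents {q r : 𝓢(ℝ, ℂ)} {ζ : ℂ} {f : ℝ → Fin 2 → ℂ} :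
    IsSolution ((-I) • r) ((-I) • q) (I * ζ) (swapComponents f) ↔ IsSolution q r ζ f := by
  rw [isSolution_iff, isSolution_iff]
  refine forall_congr' fun x => ?_
  rw [and_comm]
  have hI := I_sq
  refine and_congr (iff_of_eq ?_) (iff_of_eq ?_)
  · change HasDerivAt (fun x => f x 0) _ x = _
    congr 1
    simp only [smul_apply, smul_eq_mul, swapComponents, Matrix.cons_val_zero,
      Matrix.cons_val_one, Matrix.cons_val_fin_one, mul_pow]
    grind
  · change HasDerivAt (fun x => f x 1) _ x = _
    congr 1
    simp only [smul_apply, smul_eq_mul, swapComponents, Matrix.cons_val_zero,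
      Matrix.cons_val_one, Matrix.cons_val_fin_one, mul_pow]
    grind

/-- Under `(q, r, ζ) ↦ (iq(-·), ir(-·), iζ)` every entry of the matrix changes sign and is evaluated
at `-x`, matching the sign produced by differentiating `f(-x)`. -/
theorem isSolution_reflectVar {q r : 𝓢(ℝ, ℂ)} {ζ : ℂ} {f : ℝ → Fin 2 → ℂ} :
    IsSolution (I • q.reflect) (I • r.reflect) (I * ζ) (reflectVar f) ↔ IsSolution q r ζ f := by
  have hI := I_sq
  rw [isSolution_iff, isSolution_iff, forall_and, forall_and]
  refine and_congr ?_ ?_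
  · rw [← forall_hasDerivAt_comp_neg (f := fun x => f x 0)]
    refine forall_congr' fun x => iff_of_eq ?_
    change HasDerivAt (fun x => f (-x) 0) _ x = _
    congr 1
    simp only [smul_apply, SchwartzMap.reflect_apply, smul_eq_mul, reflectVar, mul_pow]
    grind
  · rw [← forall_hasDerivAt_comp_neg (f := fun x => f x 1)]
    refine forall_congr' fun x => iff_of_eq ?_
    change HasDerivAt (fun x => f (-x) 1) _ x = _
    congr 1
    simp only [smul_apply, SchwartzMap.reflect_apply, smul_eq_mul, reflectVar, mul_pow]
    grind

theorem isJostPsi_swapComponents {q r : 𝓢(ℝ, ℂ)} {ζ : ℂ} {f : ℝ → Fin 2 → ℂ} :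
    IsJostPsi ((-I) • r) ((-I) • q) (I * ζ) (swapComponents f) ↔ IsJostPsiBar q r ζ f := by
  have e : I * (I * ζ) ^ 2 = -I * ζ ^ 2 := by linear_combination I * ζ ^ 2 * I_sq
  refine ⟨fun h => ⟨isSolution_swapComponents.1 h.1, ?_, h.2⟩,
    fun h => ⟨isSolution_swapComponents.2 h.1, h.3, ?_⟩⟩
  · have := h.3
    rwa [e] at this
  · rw [e]
    exact h.2

theorem tendsto_atBot_iff_comp_neg {f : ℝ → ℂ} {a : ℂ} :
    Tendsto f atBot (𝓝 a) ↔ Tendsto (fun x => f (-x)) atTop (𝓝 a) := by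
  rw [← map_neg_atTop, tendsto_map'_iff]
  rfl

theorem isJostPsi_reflectVar {q r : 𝓢(ℝ, ℂ)} {ζ : ℂ} {f : ℝ → Fin 2 → ℂ} :
    IsJostPsi (I • q.reflect) (I • r.reflect) (I * ζ) (reflectVar f) ↔ IsJostPhiBar q r ζ f := by
  have e : ∀ x : ℝ, I * (I * ζ) ^ 2 * x = I * ζ ^ 2 * (-x : ℝ) := fun x => by
    push_cast; linear_combination I * ζ ^ 2 * x * I_sq
  refine ⟨fun h => ⟨isSolution_reflectVar.1 h.1, tendsto_atBot_iff_comp_neg.2 h.2,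
    tendsto_atBot_iff_comp_neg.2 ?_⟩, fun h => ⟨isSolution_reflectVar.2 h.1,
    tendsto_atBot_iff_comp_neg.1 h.2, ?_⟩⟩
  · have := h.3
    simp only [e] at this
    exact this
  · simp only [e]
    exact tendsto_atBot_iff_comp_neg.1 h.3

/-- The two symmetries combined: `λ` changes sign twice, so the half-plane is preserved. They give
`-ζ` with `r(-·)`, `q(-·)`; only the products `ζq`, `ζr`, `qr`, `ζ²` matter, so the sign moves from
`ζ` to the potentials. -/
theorem isJostPsi_swapComponents_reflectVar {q r : 𝓢(ℝ, ℂ)} {ζ : ℂ} {f : ℝ → Fin 2 → ℂ} :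
    IsJostPsi (-r.reflect) (-q.reflect) ζ (swapComponents (reflectVar f)) ↔
      IsJostPhi q r ζ f := by
  have e : ∀ x : ℝ, I * ζ ^ 2 * x = -I * ζ ^ 2 * (-x : ℝ) := fun x => by push_cast; ring
  have hs : IsSolution (-r.reflect) (-q.reflect) ζ (swapComponents (reflectVar f)) ↔
      IsSolution q r ζ f := by
    have hI := I_sq
    rw [isSolution_iff, isSolution_iff, forall_and, forall_and, and_comm]
    refine and_congr ?_ ?_
    · rw [← forall_hasDerivAt_comp_neg (f := fun x => f x 0)]
      refine forall_congr' fun x => iff_of_eq ?_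
      change HasDerivAt (fun x => f (-x) 0) _ x = _
      congr 1
      simp only [neg_apply, SchwartzMap.reflect_apply, swapComponents, reflectVar,
        Matrix.cons_val_zero, Matrix.cons_val_one, Matrix.cons_val_fin_one]
      ring
    · rw [← forall_hasDerivAt_comp_neg (f := fun x => f x 1)]
      refine forall_congr' fun x => iff_of_eq ?_
      change HasDerivAt (fun x => f (-x) 1) _ x = _
      congr 1
      simp only [neg_apply, SchwartzMap.reflect_apply, swapComponents, reflectVar,
        Matrix.cons_val_zero, Matrix.cons_val_one, Matrix.cons_val_fin_one]
      ring
  refine ⟨fun h => ⟨hs.1 h.1, tendsto_atBot_iff_comp_neg.2 ?_, tendsto_atBot_iff_comp_neg.2 h.2⟩,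
    fun h => ⟨hs.2 h.1, tendsto_atBot_iff_comp_neg.1 h.3, ?_⟩⟩
  · have := h.3
    simp only [e] at this
    exact this
  · simp only [e]
    exact tendsto_atBot_iff_comp_neg.1 h.2

theorem im_I_mul_sq (ζ : ℂ) : ((I * ζ) ^ 2).im = -(ζ ^ 2).im := by
  rw [mul_pow, I_sq, neg_one_mul, neg_im]

/-- The symmetry is an involution of the space of functions, so unique existence transfers along the
bijection. -/
theorem existsUnique_isJostPsiBar (q r : 𝓢(ℝ, ℂ)) {ζ : ℂ} (hζ : (ζ ^ 2).im ≤ 0) :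
    ∃! f : ℝ → Fin 2 → ℂ, IsJostPsiBar q r ζ f :=
  (swapComponents_involutive.toPerm.existsUnique_congr fun {_} => isJostPsi_swapComponents.symm).2
    (existsUnique_isJostPsi _ _ (by rw [im_I_mul_sq]; linarith))

theorem existsUnique_isJostPhiBar (q r : 𝓢(ℝ, ℂ)) {ζ : ℂ} (hζ : (ζ ^ 2).im ≤ 0) :
    ∃! f : ℝ → Fin 2 → ℂ, IsJostPhiBar q r ζ f :=
  (reflectVar_involutive.toPerm.existsUnique_congr fun {_} => isJostPsi_reflectVar.symm).2
    (existsUnique_isJostPsi _ _ (by rw [im_I_mul_sq]; linarith))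

theorem existsUnique_isJostPhi (q r : 𝓢(ℝ, ℂ)) {ζ : ℂ} (hζ : 0 ≤ (ζ ^ 2).im) :
    ∃! f : ℝ → Fin 2 → ℂ, IsJostPhi q r ζ f :=
  ((reflectVar_involutive.toPerm.trans swapComponents_involutive.toPerm).existsUnique_congr
    fun {_} => isJostPsi_swapComponents_reflectVar.symm).2 (existsUnique_isJostPsi _ _ hζ)

/-! ### Behaviour of `∫ σ` under the symmetries. -/

theorem integrable_sigma (q r : 𝓢(ℝ, ℂ)) : Integrable (sigma q r) := by
  obtain ⟨Bq, hBq0, hBq⟩ := q.exists_norm_le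
  obtain ⟨Br, hBr0, hBr⟩ := r.exists_norm_le
  have hr'i : Integrable (fun y => deriv r y) := (SchwartzMap.derivCLM ℝ ℂ r).integrable
  have hqc := q.continuous
  have hrc := r.continuous
  have i1 : Integrable fun x => (-(I / 2) * q x) * deriv r x := by
    refine hr'i.bdd_mul (c := 1 / 2 * Bq) (by fun_prop) (Eventually.of_forall fun x => ?_)
    have : ‖-(I / 2)‖ = 1 / 2 := by simp
    rw [norm_mul, this]
    gcongr
    exact hBq x
  have i2 : Integrable fun x => (1 / 4 * q x ^ 2 * r x) * r x := by
    refine r.integrable.bdd_mul (c := 1 / 4 * Bq ^ 2 * Br) (by fun_prop)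
      (Eventually.of_forall fun x => ?_)
    have : ‖(1 / 4 : ℂ)‖ = 1 / 4 := by norm_num
    rw [norm_mul, norm_mul, norm_pow, this]
    gcongr
    exacts [hBq x, hBr x]
  refine (i1.sub i2).congr (Eventually.of_forall fun x => ?_)
  simp only [sigma, Pi.sub_apply]
  ring

/-- Exchanging the roles of `q` and `r` in `sigma` adds the total derivative `(i/2) (q r)'`. -/
theorem hasDerivAt_mul_schwartz (q r : 𝓢(ℝ, ℂ)) (x : ℝ) :
    HasDerivAt (fun y => I / 2 * (q y * r y))
      (sigma ((-I) • r) ((-I) • q) x - sigma q r x) x := by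
  convert! ((q.hasDerivAt x).mul (r.hasDerivAt x)).const_mul (I / 2) using 1
  simp only [sigma, SchwartzMap.deriv_smul, smul_apply, smul_eq_mul]
  have hI := I_sq
  grind

theorem tendsto_mul_schwartz (q r : 𝓢(ℝ, ℂ)) {l : Filter ℝ} (hl : l ≤ cocompact ℝ) :
    Tendsto (fun y => I / 2 * (q y * r y)) l (𝓝 0) := by
  simpa using ((q.tendsto_cocompact.mono_left hl).mul
    (r.tendsto_cocompact.mono_left hl)).const_mul (I / 2)

theorem integral_Ioi_sigma_swap (q r : 𝓢(ℝ, ℂ)) (x : ℝ) :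
    ∫ y in Ioi x, sigma ((-I) • r) ((-I) • q) y =
      (∫ y in Ioi x, sigma q r y) - I / 2 * (q x * r x) := by
  have i1 := integrable_sigma ((-I) • r) ((-I) • q)
  have i2 := integrable_sigma q r
  have := integral_Ioi_of_hasDerivAt_of_tendsto' (a := x)
    (fun y _ => hasDerivAt_mul_schwartz q r y) (i1.sub i2).integrableOn
    (tendsto_mul_schwartz q r atTop_le_cocompact)
  rw [integral_sub i1.integrableOn i2.integrableOn] at this
  linear_combination this

theorem integral_Iic_sigma_swap (q r : 𝓢(ℝ, ℂ)) (x : ℝ) :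
    ∫ y in Iic x, sigma ((-I) • r) ((-I) • q) y =
      (∫ y in Iic x, sigma q r y) + I / 2 * (q x * r x) := by
  have i1 := integrable_sigma ((-I) • r) ((-I) • q)
  have i2 := integrable_sigma q r
  have := integral_Iic_of_hasDerivAt_of_tendsto' (a := x)
    (fun y _ => hasDerivAt_mul_schwartz q r y) (i1.sub i2).integrableOn
    (tendsto_mul_schwartz q r atBot_le_cocompact)
  rw [integral_sub i1.integrableOn i2.integrableOn] at this
  linear_combination this

/-- `σ` is simply reflected: the `-1` from `i·i` cancels the sign of the reflected derivative, and
`i⁴ = 1` in the quartic term. -/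
theorem integral_Ioi_sigma_reflect (q r : 𝓢(ℝ, ℂ)) (x : ℝ) :
    ∫ y in Ioi (-x), sigma (I • q.reflect) (I • r.reflect) y = ∫ y in Iic x, sigma q r y := by
  have := integral_comp_neg_Ioi (-x) (sigma q r)
  rw [neg_neg] at this
  rw [← this]
  congr 1
  funext y
  simp only [sigma, SchwartzMap.deriv_smul, smul_apply, smul_eq_mul,
    SchwartzMap.deriv_reflect, SchwartzMap.reflect_apply]
  have hI := I_sq
  grind

theorem integral_Ioi_sigma_swap_reflect (q r : 𝓢(ℝ, ℂ)) (x : ℝ) :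
    ∫ y in Ioi (-x), sigma (-r.reflect) (-q.reflect) y =
      (∫ y in Iic x, sigma q r y) + I / 2 * (q x * r x) := by
  rw [← integral_Iic_sigma_swap]
  have := integral_comp_neg_Ioi (-x) (sigma ((-I) • r) ((-I) • q))
  rw [neg_neg] at this
  rw [← this]
  congr 1
  funext y
  have hn : deriv (-q.reflect : 𝓢(ℝ, ℂ)) y = deriv q (-y) := by
    have := (q.reflect.hasDerivAt y).neg.deriv
    rw [SchwartzMap.deriv_reflect, neg_neg] at this
    exact this
  simp only [sigma, SchwartzMap.deriv_smul, smul_apply, smul_eq_mul, hn,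
    neg_apply, SchwartzMap.reflect_apply]
  have hI := I_sq
  grind

/-! ### Transport of the asymptotics to the other Jost solutions. -/

/-- Change of spectral variable by a modulus-preserving map, which leaves the order of the remainder
intact. The constant `c` absorbs the discrepancy between dividing by `ζ` and by its image. -/
theorem ExpBracket.comp {l l' : Filter ℂ} {s s' c : ℂ} {x x' : ℝ} {F G F' G' : ℂ → ℂ}
    (h : ExpBracket l s x F G) {ϕ : ℂ → ℂ} (hϕ : Tendsto ϕ l' l) (hn : ∀ ζ, ‖ϕ ζ‖ = ‖ζ‖)
    (he : ∀ ζ, s * ϕ ζ ^ 2 * x = s' * ζ ^ 2 * x')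
    (hF : ∀ᶠ ζ in l', F' ζ = c * F (ϕ ζ)) (hG : ∀ᶠ ζ in l', G' ζ = c * G (ϕ ζ)) :
    ExpBracket l' s' x' F' G' := by
  obtain ⟨ρ, hρ, hρe⟩ := h
  refine ⟨fun ζ => c * ρ (ϕ ζ), ?_, ?_⟩
  · refine ((hρ.comp_tendsto hϕ).const_mul_left c).trans (IsBigO.of_bound 1 ?_)
    refine Eventually.of_forall fun ζ => ?_
    simp [hn]
  · filter_upwards [hF, hG, hϕ.eventually hρe] with ζ h1 h2 h3
    rw [h1, h2, h3]
    have : s * I * ϕ ζ ^ 2 * x = s' * I * ζ ^ 2 * x' := by linear_combination I * he ζ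
    rw [this]
    ring

theorem tendsto_I_mul_lamInf : Tendsto (fun ζ => I * ζ) lamInfLower lamInfUpper := by
  refine tendsto_comap_iff.2 ?_
  have e : (fun ζ : ℂ => ζ ^ 2) ∘ (fun ζ => I * ζ) = (fun l => -l) ∘ fun ζ => ζ ^ 2 := by
    funext ζ
    simp [mul_pow]
  rw [e]
  refine Tendsto.comp ?_ tendsto_comap
  refine tendsto_inf.2 ⟨?_, ?_⟩
  · exact (tendsto_neg_cobounded).mono_left inf_le_left
  · refine (tendsto_principal_principal.2 fun l hl => ?_).mono_left inf_le_right
    simpa using hl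

theorem neg_I_mul_I_mul (ζ : ℂ) : -I * (I * ζ) = ζ := by linear_combination -ζ * I_sq

theorem I_mul_neg_I_mul (ζ : ℂ) : I * (-I * ζ) = ζ := by linear_combination -ζ * I_sq

theorem im_neg_I_mul_sq (ζ : ℂ) : ((-I * ζ) ^ 2).im = -(ζ ^ 2).im := by
  rw [mul_pow, neg_sq, I_sq, neg_one_mul, neg_im]

theorem eventually_lamInfLower_ne_zero : ∀ᶠ ζ in lamInfLower, ζ ≠ 0 := by
  filter_upwards [tendsto_I_mul_lamInf.eventually eventually_lamInfUpper] with ζ h h0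
  exact h.2 (by simp [h0])

theorem expBracket_phi (q r : 𝓢(ℝ, ℂ)) {φ : ℂ → ℝ → Fin 2 → ℂ}
    (hφ : ∀ ζ : ℂ, 0 ≤ (ζ ^ 2).im → IsJostPhi q r ζ (φ ζ)) (x : ℝ) :
    ExpBracket lamInfUpper (-1) x (fun ζ => φ ζ x 0)
      (fun ζ => 1 - 1 / (2 * I * ζ ^ 2) * ∫ y in Iic x, sigma q r y) ∧
    ExpBracket lamInfUpper (-1) x (fun ζ => φ ζ x 1 / ζ)
      (fun ζ => I * r x / (2 * ζ ^ 2)) := by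
  obtain ⟨h1, h2⟩ := expBracket_psi (-r.reflect) (-q.reflect)
    (ψ := fun ζ => swapComponents (reflectVar (φ ζ)))
    (fun ζ hζ => isJostPsi_swapComponents_reflectVar.2 (hφ ζ hζ)) (-x)
  have he : ∀ ζ : ℂ, 1 * id ζ ^ 2 * ((-x : ℝ) : ℂ) = -1 * ζ ^ 2 * x := fun ζ => by
    push_cast; simp only [id]; ring
  refine ⟨h2.comp (c := 1) tendsto_id (fun _ => rfl) he ?_ ?_,
    h1.comp (c := 1) tendsto_id (fun _ => rfl) he ?_ ?_⟩
  · exact Eventually.of_forall fun ζ => by simp [swapComponents, reflectVar]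
  · filter_upwards [eventually_lamInfUpper] with ζ ⟨_, hζ⟩
    -- The boundary term `(i/2) qr` cancels the `qr/(4λ)` inherited from `ψ₂`.
    rw [integral_Ioi_sigma_swap_reflect]
    simp only [neg_apply, SchwartzMap.reflect_apply, neg_neg, id]
    field_simp
    ring
  · exact Eventually.of_forall fun ζ => by simp [swapComponents, reflectVar]
  · filter_upwards [eventually_lamInfUpper] with ζ ⟨_, hζ⟩
    simp only [neg_apply, SchwartzMap.reflect_apply, neg_neg, id]
    field_simp
    linear_combination r x * I_sq

theorem expBracket_psiBar (q r : 𝓢(ℝ, ℂ)) {ψbar : ℂ → ℝ → Fin 2 → ℂ}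
    (hψ : ∀ ζ : ℂ, (ζ ^ 2).im ≤ 0 → IsJostPsiBar q r ζ (ψbar ζ)) (x : ℝ) :
    ExpBracket lamInfLower (-1) x (fun ζ => ψbar ζ x 0)
      (fun ζ => 1 + 1 / (2 * I * ζ ^ 2) * ∫ y in Ioi x, sigma q r y) ∧
    ExpBracket lamInfLower (-1) x (fun ζ => ψbar ζ x 1 / ζ)
      (fun ζ => -(r x / (2 * I * ζ ^ 2))) := by
  obtain ⟨h1, h2⟩ := expBracket_psi ((-I) • r) ((-I) • q)
    -- The parameter `-iζ` is the inverse of `ζ ↦ iζ`, so substituting `iζ` below returns `ψbar ζ`.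
    (ψ := fun ζ => swapComponents (ψbar (-I * ζ))) (fun ζ hζ => by
      have := isJostPsi_swapComponents.2 (hψ (-I * ζ) (by rw [im_neg_I_mul_sq]; linarith))
      rwa [I_mul_neg_I_mul] at this) x
  have hI := I_sq
  have he : ∀ ζ : ℂ, 1 * (I * ζ) ^ 2 * (x : ℂ) = -1 * ζ ^ 2 * x := fun ζ => by
    linear_combination ζ ^ 2 * x * I_sq
  refine ⟨h2.comp (c := 1) tendsto_I_mul_lamInf (fun _ => by simp) he ?_ ?_,
    -- The factor `I` compensates for division by `iζ` instead of `ζ`.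
    h1.comp (c := I) tendsto_I_mul_lamInf (fun _ => by simp) he ?_ ?_⟩
  · exact Eventually.of_forall fun ζ => by simp only [neg_I_mul_I_mul]; simp [swapComponents]
  · filter_upwards [eventually_lamInfLower_ne_zero] with ζ hζ
    -- Here too the boundary term of the exchange removes `qr/(4λ)`.
    rw [integral_Ioi_sigma_swap]
    simp only [smul_apply, smul_eq_mul, mul_pow, I_sq]
    field_simp
    grind
  · filter_upwards [eventually_lamInfLower_ne_zero] with ζ hζ
    simp only [neg_I_mul_I_mul]
    change _ = I * (ψbar ζ x 1 / _)
    field_simp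
  · filter_upwards [eventually_lamInfLower_ne_zero] with ζ hζ
    simp only [smul_apply, smul_eq_mul, mul_pow, I_sq]
    field_simp
    grind

theorem expBracket_phiBar (q r : 𝓢(ℝ, ℂ)) {φbar : ℂ → ℝ → Fin 2 → ℂ}
    (hφ : ∀ ζ : ℂ, (ζ ^ 2).im ≤ 0 → IsJostPhiBar q r ζ (φbar ζ)) (x : ℝ) :
    ExpBracket lamInfLower 1 x (fun ζ => φbar ζ x 0 / ζ) (fun ζ => q x / (2 * I * ζ ^ 2)) ∧
    ExpBracket lamInfLower 1 x (fun ζ => φbar ζ x 1)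
      (fun ζ => 1 + q x * r x / (4 * ζ ^ 2)
        + 1 / (2 * I * ζ ^ 2) * ∫ y in Iic x, sigma q r y) := by
  obtain ⟨h1, h2⟩ := expBracket_psi (I • q.reflect) (I • r.reflect)
    (ψ := fun ζ => reflectVar (φbar (-I * ζ))) (fun ζ hζ => by
      have := isJostPsi_reflectVar.2 (hφ (-I * ζ) (by rw [im_neg_I_mul_sq]; linarith))
      rwa [I_mul_neg_I_mul] at this) (-x)
  have hI := I_sq
  have he : ∀ ζ : ℂ, 1 * (I * ζ) ^ 2 * ((-x : ℝ) : ℂ) = 1 * ζ ^ 2 * x := fun ζ => by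
    push_cast; linear_combination -ζ ^ 2 * x * I_sq
  refine ⟨h1.comp (c := I) tendsto_I_mul_lamInf (fun _ => by simp) he ?_ ?_,
    h2.comp (c := 1) tendsto_I_mul_lamInf (fun _ => by simp) he ?_ ?_⟩
  · filter_upwards [eventually_lamInfLower_ne_zero] with ζ hζ
    simp only [neg_I_mul_I_mul, reflectVar, neg_neg]
    field_simp
  · filter_upwards [eventually_lamInfLower_ne_zero] with ζ hζ
    simp only [smul_apply, SchwartzMap.reflect_apply, neg_neg, smul_eq_mul, mul_pow,
      I_sq]
    field_simp
    grind
  · exact Eventually.of_forall fun ζ => by simp only [neg_I_mul_I_mul]; simp [reflectVar]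
  · filter_upwards [eventually_lamInfLower_ne_zero] with ζ hζ
    rw [integral_Ioi_sigma_reflect]
    simp only [smul_apply, SchwartzMap.reflect_apply, neg_neg, smul_eq_mul, mul_pow,
      I_sq]
    field_simp
    grind

end

theorem theorem3p5 (q r : 𝓢(ℝ, ℂ)) :
    -- the Jost solutions exist and are unique in the respective closed quadrants
    (∀ ζ : ℂ, 0 ≤ (ζ ^ 2).im →
      (∃! f : ℝ → Fin 2 → ℂ, IsJostPsi q r ζ f) ∧ (∃! f : ℝ → Fin 2 → ℂ, IsJostPhi q r ζ f)) ∧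
    (∀ ζ : ℂ, (ζ ^ 2).im ≤ 0 →
      (∃! f : ℝ → Fin 2 → ℂ, IsJostPsiBar q r ζ f) ∧
        (∃! f : ℝ → Fin 2 → ℂ, IsJostPhiBar q r ζ f)) ∧
    -- asymptotics as `λ → ∞` in the closed upper half-plane
    (∀ ψ φ : ℂ → ℝ → Fin 2 → ℂ,
      (∀ ζ : ℂ, 0 ≤ (ζ ^ 2).im → IsJostPsi q r ζ (ψ ζ)) →
      (∀ ζ : ℂ, 0 ≤ (ζ ^ 2).im → IsJostPhi q r ζ (φ ζ)) →
      ∀ x : ℝ,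
        ExpBracket lamInfUpper 1 x (fun ζ => ψ ζ x 0 / ζ)
          (fun ζ => q x / (2 * I * ζ ^ 2)) ∧
        ExpBracket lamInfUpper 1 x (fun ζ => ψ ζ x 1)
          (fun ζ => 1 + q x * r x / (4 * ζ ^ 2)
            - 1 / (2 * I * ζ ^ 2) * ∫ y in Set.Ioi x, sigma q r y) ∧
        ExpBracket lamInfUpper (-1) x (fun ζ => φ ζ x 0)
          (fun ζ => 1 - 1 / (2 * I * ζ ^ 2) * ∫ y in Set.Iic x, sigma q r y) ∧
        ExpBracket lamInfUpper (-1) x (fun ζ => φ ζ x 1 / ζ)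
          (fun ζ => I * r x / (2 * ζ ^ 2))) ∧
    -- asymptotics as `λ → ∞` in the closed lower half-plane
    (∀ ψbar φbar : ℂ → ℝ → Fin 2 → ℂ,
      (∀ ζ : ℂ, (ζ ^ 2).im ≤ 0 → IsJostPsiBar q r ζ (ψbar ζ)) →
      (∀ ζ : ℂ, (ζ ^ 2).im ≤ 0 → IsJostPhiBar q r ζ (φbar ζ)) →
      ∀ x : ℝ,
        ExpBracket lamInfLower (-1) x (fun ζ => ψbar ζ x 0)
          (fun ζ => 1 + 1 / (2 * I * ζ ^ 2) * ∫ y in Set.Ioi x, sigma q r y) ∧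
        ExpBracket lamInfLower (-1) x (fun ζ => ψbar ζ x 1 / ζ)
          (fun ζ => -(r x / (2 * I * ζ ^ 2))) ∧
        ExpBracket lamInfLower 1 x (fun ζ => φbar ζ x 0 / ζ)
          (fun ζ => q x / (2 * I * ζ ^ 2)) ∧
        ExpBracket lamInfLower 1 x (fun ζ => φbar ζ x 1)
          (fun ζ => 1 + q x * r x / (4 * ζ ^ 2)
            + 1 / (2 * I * ζ ^ 2) * ∫ y in Set.Iic x, sigma q r y)) := by
  exact ⟨fun ζ hζ => ⟨existsUnique_isJostPsi q r hζ, existsUnique_isJostPhi q r hζ⟩,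
    fun ζ hζ => ⟨existsUnique_isJostPsiBar q r hζ, existsUnique_isJostPhiBar q r hζ⟩,
    fun ψ φ hψ hφ x => ⟨(expBracket_psi q r hψ x).1, (expBracket_psi q r hψ x).2,
      (expBracket_phi q r hφ x).1, (expBracket_phi q r hφ x).2⟩,
    fun ψbar φbar hψ hφ x => ⟨(expBracket_psiBar q r hψ x).1, (expBracket_psiBar q r hψ x).2,
      (expBracket_phiBar q r hφ x).1, (expBracket_phiBar q r hφ x).2⟩⟩
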